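/- Let $p\ge 0$, let $\boldsymbol\theta=(\theta_{ij})_{1\le i\le j\le p}\in\mathbb R^m$ with $m=p(p+1)/2$, and for $\mathbf x\in\{0,1\}^p$ let $\boldsymbol\psi(\mathbf x)=(x_ix_j)_{1\le i\le j\le p}\in\{0,1\}^m$. Let $$\mathrm P_{\boldsymbol\theta}(\mathbf x)=\exp\bigl(\boldsymbol\theta^\top\boldsymbol\psi(\mathbf x)-A(\boldsymbol\theta)\bigr),\qquad A(\boldsymbol\theta)=\log\sum_{\mathbf x\in\{0,1\}^p}\exp\bigl(\boldsymbol\theta^\top\boldsymbol\psi(\mathbf x)\bigr),$$ be the binary pairwise Markov network with parameter $\boldsymbol\theta$. For a dataset $\mathbb X$ of $n$ elements of $\{0,1\}^p$ let $\mathbb E_{\mathbb X}\boldsymbol\psi=\frac1n\sum_{\mathbf x\in\mathbb X}\boldsymbol\psi(\mathbf x)$ and $f(\boldsymbol\theta)=-\frac1n\sum_{\mathbf x\in\mathbb X}\boldsymbol\theta^\top\boldsymbol\psi(\mathbf x)+A(\boldsymbol\theta)$. Gibbs-1 resamples the coordinates $i=1,2,\dots,p$ one after the other, in this order, each from $\mathrm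 P_{\boldsymbol\theta}(X_i\mid\mathbf x_{-i})$; Gibbs-$\tau$ applies Gibbs-1 successively $\tau\ge 0$ times. Let $q\ge 2$, let $\tilde{\mathbf x}_0\in\{0,1\}^p$ be arbitrary, and let $\tilde{\mathbf x}_\tau^{(1)},\dots,\tilde{\mathbf x}_\tau^{(q)}$ be the outcomes of $q$ independent runs of Gibbs-$\tau$ under $\boldsymbol\theta$, each started at $\tilde{\mathbf x}_0$. The gradient approximation error is $$\boldsymbol\delta(\boldsymbol\theta)=\Bigl(\frac1q\sum_{k=1}^q\boldsymbol\psi(\tilde{\mathbf x}_\tau^{(k)})-\mathbb E_{\mathbb X}\boldsymbol\psi\Bigr)-\nabla f(\boldsymbol\theta),$$ and, for each of the $m$ components $\psi_j$ of $\boldsymbol\psi$, $V_{\psi_j}=\frac1{q-1}\sum_{k=1}^q\bigl(\psi_j(\tilde{\mathbf x}_\tau^{(k)})-\frac1q\sum_{l=1}^q\psi_j(\tilde{\mathbf x}_\tau^{(l)})\bigr)^2$ is its sample variance. For $i,j\in\{1,\dots,p\}$ put $\xi_{ij}=\theta_{\min\{i,j\},\max\{i,j\}}$ and $$U_{ij}=\frac{|\exp(-\xi_{ij})-1|\,b^*}{(1+b^*\exp(-\xi_{ij}))(1+b^*)},\qquad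 b^*=\max\{r,\min\{s,\exp(\xi_{ij}/2)\}\},$$ $$s=\exp\Bigl(-\xi_{ii}-\sum_{k\ne i,j}\xi_{ik}\max\{-\mathrm{sgn}(\xi_{ik}),0\}\Bigr),\qquad r=\exp\Bigl(-\xi_{ii}-\sum_{k\ne i,j}\xi_{ik}\max\{\mathrm{sgn}(\xi_{ik}),0\}\Bigr).$$ Let $\mathbf B_i$ be the $p\times p$ identity matrix with its $i$-th row replaced by the $i$-th row of $\mathbf U=(U_{ij})$, let $\mathbf B=\mathbf B_p\mathbf B_{p-1}\cdots\mathbf B_1$, and let $\mathscr G(\mathbf M)=\sum_{i,j}M_{ij}$ be the sum of all entries of a matrix. Then for all $\beta_1,\dots,\beta_m>0$, with probability at least $1-2\sum_{j=1}^m\beta_j$, $$\|\boldsymbol\delta(\boldsymbol\theta)\|_2\le 2\sqrt m\left(\mathscr G(\mathbf B^\tau)+\sqrt{\frac{\sum_{j=1}^m\epsilon_j^2}{4m}}\right),\qquad\text{where}\quad \epsilon_j=2\left(\sqrt{\frac{V_{\psi_j}\ln(2/\beta_j)}{2q}}+\frac{7\ln(2/\beta_j)}{3(q-1)}\right).$$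 (If some $\beta_j\ge 1/2$ the claimed probability is at most $0$ and nothing is asserted; for $m=0$ both sides of the inequality are read as $0$.) -/

import Mathlib

open MeasureTheory ProbabilityTheory

namespace BPMN

noncomputable section

/-- Assignments `x ∈ {0,1}^p`. -/
abbrev Config (p : ℕ) : Type := Fin p → Bool

/-- Index set `{(i, j) : i ≤ j}` of the components of the parameter and of the sufficient
statistics; it has `m = p (p + 1) / 2` elements. -/
abbrev PairIdx (p : ℕ) : Type := {e : Fin p × Fin p // e.1 ≤ e.2}

/-- The parameter space `ℝ^m`, with the Euclidean norm. -/
abbrev Param (p : ℕ) : Type := EuclideanSpace ℝ (PairIdx p)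

/-- The number `m` of sufficient statistics, i.e. the dimension of the parameter. -/
def dim (p : ℕ) : ℕ := Fintype.card (PairIdx p)

/-- The value `0` or `1` of a binary variable as a real number. -/
def bit (b : Bool) : ℝ := if b then 1 else 0

/-- The sufficient statistics `ψ(x) ∈ {0,1}^m`, with `ψ_{ij}(x) = x_i x_j` for `i ≤ j`. -/
def suffStat {p : ℕ} (x : Config p) : Param p :=
  WithLp.toLp 2 (fun e => bit (x e.1.1) * bit (x e.1.2))

/-- The log partition function `A(θ) = log ∑_x exp(θᵀ ψ(x))`. -/
def logPartition {p : ℕ} (θ : Param p) : ℝ :=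
  Real.log (∑ x : Config p, Real.exp (inner ℝ θ (suffStat x)))

/-- The binary pairwise Markov network `P_θ(x) = exp(θᵀ ψ(x)) / exp(A(θ))`. -/
def prob {p : ℕ} (θ : Param p) (x : Config p) : ℝ :=
  Real.exp (inner ℝ θ (suffStat x)) / Real.exp (logPartition θ)

/-- Average of the sufficient statistics over a finite family of assignments. -/
def empMean {p n : ℕ} (s : Fin n → Config p) : Param p :=
  (n : ℝ)⁻¹ • ∑ k, suffStat (s k)

/-- The differentiable part `f(θ) = -(1/n) ∑_{x ∈ 𝕏} θᵀ ψ(x) + A(θ)` of the objective,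
for a dataset of `n` assignments. -/
def negLogLik {p n : ℕ} (data : Fin n → Config p) (θ : Param p) : ℝ :=
  -((n : ℝ)⁻¹ * ∑ k, inner ℝ θ (suffStat (data k))) + logPartition θ

/-- The approximate gradient `Δf = E_𝕊 ψ - E_𝕏 ψ` computed from `q` samples. -/
def approxGrad {p n q : ℕ} (data : Fin n → Config p) (s : Fin q → Config p) : Param p :=
  empMean s - empMean data

/-- The gradient approximation error `δ(θ) = Δf(θ) - ∇f(θ)`. -/
def gradError {p n q : ℕ} (data : Fin n → Config p) (s : Fin q → Config p) (θ : Param p) :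
    Param p :=
  approxGrad data s - gradient (negLogLik data) θ

/-! ### Gibbs sampling -/

/-- The conditional probability `P_θ(X_i = b | x_{-i})`. -/
def condProb {p : ℕ} (θ : Param p) (i : Fin p) (x : Config p) (b : Bool) : ℝ :=
  prob θ (Function.update x i b) / ∑ c : Bool, prob θ (Function.update x i c)

theorem prob_pos {p : ℕ} (θ : Param p) (x : Config p) : 0 < prob θ x :=
  div_pos (Real.exp_pos _) (Real.exp_pos _)

theorem condProb_nonneg {p : ℕ} (θ : Param p) (i : Fin p) (x : Config p) (b : Bool) :
    0 ≤ condProb θ i x b :=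
  div_nonneg (prob_pos _ _).le (Finset.sum_nonneg fun _ _ => (prob_pos _ _).le)

theorem sum_condProb {p : ℕ} (θ : Param p) (i : Fin p) (x : Config p) :
    ∑ b : Bool, condProb θ i x b = 1 := by
  unfold condProb
  rw [← Finset.sum_div]
  exact div_self (Finset.sum_pos (fun _ _ => prob_pos _ _) Finset.univ_nonempty).ne'

/-- The conditional distribution of `X_i` given `x_{-i}`. -/
def condPMF {p : ℕ} (θ : Param p) (i : Fin p) (x : Config p) : PMF Bool :=
  PMF.ofFintype (fun b => ENNReal.ofReal (condProb θ i x b)) (by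
    rw [← ENNReal.ofReal_sum_of_nonneg (fun b _ => condProb_nonneg θ i x b), sum_condProb,
      ENNReal.ofReal_one])

/-- Resample the `i`-th coordinate from its conditional distribution. -/
def gibbsSite {p : ℕ} (θ : Param p) (x : Config p) (i : Fin p) : PMF (Config p) :=
  (condPMF θ i x).map (Function.update x i)

/-- Gibbs-1: resample the coordinates `1, 2, …, p` one after the other, in this order. -/
def gibbsScan {p : ℕ} (θ : Param p) (x : Config p) : PMF (Config p) :=
  (List.finRange p).foldlM (gibbsSite θ) x

/-- Gibbs-τ: the distribution of the state after `τ` successive applications of Gibbs-1,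
started at `x₀`. -/
def gibbs {p : ℕ} (θ : Param p) (x₀ : Config p) : ℕ → PMF (Config p)
  | 0 => PMF.pure x₀
  | t + 1 => (gibbs θ x₀ t).bind (gibbsScan θ)

/-! ### The matrix `B` -/

/-- `ξ_{ij} = θ_{min(i,j), max(i,j)}`. -/
def xi {p : ℕ} (θ : Param p) (i j : Fin p) : ℝ := θ ⟨(min i j, max i j), min_le_max⟩

/-- `s = exp(-ξ_{ii} - ∑_{k ≠ i, k ≠ j} ξ_{ik} max{-sgn(ξ_{ik}), 0})`. -/
def sBound {p : ℕ} (θ : Param p) (i j : Fin p) : ℝ :=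
  Real.exp (-xi θ i i -
    ∑ k with k ≠ i ∧ k ≠ j, xi θ i k * max (-Real.sign (xi θ i k)) 0)

/-- `r = exp(-ξ_{ii} - ∑_{k ≠ i, k ≠ j} ξ_{ik} max{sgn(ξ_{ik}), 0})`. -/
def rBound {p : ℕ} (θ : Param p) (i j : Fin p) : ℝ :=
  Real.exp (-xi θ i i -
    ∑ k with k ≠ i ∧ k ≠ j, xi θ i k * max (Real.sign (xi θ i k)) 0)

/-- `b* = max{r, min{s, exp(ξ_{ij} / 2)}}`. -/
def bStar {p : ℕ} (θ : Param p) (i j : Fin p) : ℝ :=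
  max (rBound θ i j) (min (sBound θ i j) (Real.exp (xi θ i j / 2)))

/-- The matrix `U`. -/
def matU {p : ℕ} (θ : Param p) : Matrix (Fin p) (Fin p) ℝ := Matrix.of fun i j =>
  |Real.exp (-xi θ i j) - 1| * bStar θ i j /
    ((1 + bStar θ i j * Real.exp (-xi θ i j)) * (1 + bStar θ i j))

/-- `B_i`: the identity matrix with its `i`-th row replaced by the `i`-th row of `U`. -/
def matBSite {p : ℕ} (θ : Param p) (i : Fin p) : Matrix (Fin p) (Fin p) ℝ :=
  Matrix.updateRow 1 i (matU θ i)

/-- `B = B_p B_{p-1} ⋯ B_1`. -/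
def matB {p : ℕ} (θ : Param p) : Matrix (Fin p) (Fin p) ℝ :=
  ((List.finRange p).reverse.map (matBSite θ)).prod

/-- The grand sum of a matrix: the sum of all its entries. -/
def grandSum {p : ℕ} (M : Matrix (Fin p) (Fin p) ℝ) : ℝ := ∑ i, ∑ j, M i j

/-! ### The empirical Bernstein radius -/

/-- The (unbiased) sample variance `V_{ψ_j}` of the `j`-th sufficient statistic over `q`
samples. -/
def sampleVar {p q : ℕ} (s : Fin q → Config p) (j : PairIdx p) : ℝ :=
  (∑ k, (suffStat (s k) j - empMean s j) ^ 2) / ((q : ℝ) - 1)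

/-- `ε_j = 2 (√(V_{ψ_j} ln(2/β_j) / (2q)) + 7 ln(2/β_j) / (3 (q - 1)))`, where `b` is `β_j`. -/
def epsilon {p q : ℕ} (s : Fin q → Config p) (b : ℝ) (j : PairIdx p) : ℝ :=
  2 * (Real.sqrt (sampleVar s j * Real.log (2 / b) / (2 * q)) +
    7 * Real.log (2 / b) / (3 * ((q : ℝ) - 1)))

end

end BPMN

/-! The data terms cancel, so each component of the error is a sample mean minus the model mean of
`ψ_j`. It splits into the bias of Gibbs-τ and a sampling error. Bias: resampling a coordinate acts
on functions as a conditional expectation that preserves the network distribution. If `d` bounds the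
oscillations of `g` coordinate by coordinate, then `d B_i` bounds those after resampling `i`
(`OscLE.siteOp`), since `U_ij` bounds the effect of flipping `x_j` on the conditional law of `X_i`.
Each `ψ_j` has oscillations at most 1, so after τ scans the total oscillation, and with it the bias,
is at most the grand sum of `B ^ τ`. Sampling error: for 0/1 variables the sample variance is a
function of the sample mean. Hence replacing the true variance by the empirical one in Bernstein's
inequality costs no further probabilistic estimate, only a quadratic inequality
(`le_of_le_bernstein`). Minkowski's inequality and a union bound over the components combine the
two. -/

namespace BPMN

/-! ### Expectations under finitely supported distributions -/

/-- Expectation of a real function under a probability mass function on a finite type. -/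
noncomputable def pmfExp {α : Type*} [Fintype α] (μ : PMF α) (g : α → ℝ) : ℝ :=
  ∑ x, (μ x).toReal * g x

theorem pmfExp_pure {α : Type*} [Fintype α] (a : α) (g : α → ℝ) :
    pmfExp (PMF.pure a) g = g a := by
  classical
  unfold pmfExp
  rw [Finset.sum_eq_single a]
  · simp
  · intro b _ hb
    simp [PMF.pure_apply, hb]
  · simp

theorem pmfExp_bind {α β : Type*} [Fintype α] [Fintype β] (μ : PMF α) (f : α → PMF β)
    (g : β → ℝ) : pmfExp (μ.bind f) g = pmfExp μ (fun x => pmfExp (f x) g) := by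
  unfold pmfExp
  have h : ∀ y, ((μ.bind f) y).toReal = ∑ x, (μ x).toReal * (f x y).toReal := by
    intro y
    rw [PMF.bind_apply, tsum_fintype, ENNReal.toReal_sum]
    · simp [ENNReal.toReal_mul]
    · intro x _
      exact ENNReal.mul_ne_top (PMF.apply_ne_top _ _) (PMF.apply_ne_top _ _)
  simp_rw [h, Finset.sum_mul, Finset.mul_sum]
  rw [Finset.sum_comm]
  simp_rw [mul_assoc]

theorem pmfExp_map {α β : Type*} [Fintype α] [Fintype β] (μ : PMF α) (f : α → β)
    (g : β → ℝ) : pmfExp (μ.map f) g = pmfExp μ (g ∘ f) := by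
  rw [PMF.map, pmfExp_bind]
  simp [pmfExp_pure, Function.comp_def]

/-! ### Gibbs sampling as an operator on functions -/

variable {p : ℕ}

/-- The conditional expectation operator that resamples the `i`-th coordinate. -/
noncomputable def siteOp (θ : Param p) (i : Fin p) (g : Config p → ℝ) (x : Config p) : ℝ :=
  ∑ b : Bool, condProb θ i x b * g (Function.update x i b)

/-- The operator of one systematic scan over all coordinates. -/
noncomputable def scanOp (θ : Param p) (g : Config p → ℝ) : Config p → ℝ :=
  (List.finRange p).foldr (siteOp θ) g

theorem pmfExp_gibbsSite (θ : Param p) (x : Config p) (i : Fin p) (g : Config p → ℝ) :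
    pmfExp (gibbsSite θ x i) g = siteOp θ i g x := by
  rw [gibbsSite, pmfExp_map]
  unfold pmfExp siteOp condPMF
  simp only [PMF.ofFintype_apply, Function.comp]
  refine Finset.sum_congr rfl fun b _ => ?_
  rw [ENNReal.toReal_ofReal (condProb_nonneg _ _ _ _)]

theorem pmfExp_foldlM_gibbsSite (θ : Param p) (l : List (Fin p)) (x : Config p)
    (g : Config p → ℝ) :
    pmfExp (l.foldlM (gibbsSite θ) x) g = l.foldr (siteOp θ) g x := by
  induction l generalizing x with
  | nil => exact pmfExp_pure x g
  | cons i l ih =>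
    rw [List.foldlM_cons, List.foldr_cons]
    refine (pmfExp_bind (gibbsSite θ x i) _ g).trans ?_
    simp_rw [ih]
    exact pmfExp_gibbsSite θ x i _

theorem pmfExp_gibbs (θ : Param p) (x₀ : Config p) (t : ℕ) (g : Config p → ℝ) :
    pmfExp (gibbs θ x₀ t) g = (scanOp θ)^[t] g x₀ := by
  induction t generalizing g with
  | zero => exact pmfExp_pure x₀ g
  | succ t ih =>
    rw [gibbs, pmfExp_bind, Function.iterate_succ_apply, ← ih]
    congr 1
    funext x
    exact pmfExp_foldlM_gibbsSite θ _ x g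

/-! ### Stationarity of the Markov network -/

/-- Expectation of a function under the Markov network. -/
noncomputable def netExp (θ : Param p) (g : Config p → ℝ) : ℝ := ∑ x, prob θ x * g x

theorem sum_exp_pos (θ : Param p) :
    0 < ∑ x : Config p, Real.exp (inner ℝ θ (suffStat x)) :=
  Finset.sum_pos (fun _ _ => Real.exp_pos _) Finset.univ_nonempty

theorem sum_prob (θ : Param p) : ∑ x, prob θ x = 1 := by
  unfold prob logPartition
  rw [← Finset.sum_div, Real.exp_log (sum_exp_pos θ)]
  exact div_self (sum_exp_pos θ).ne'

/-- Detailed balance: the weight of the transition from `x` to its update is unchanged by the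
involution `e`, which exchanges the old and new values of coordinate `i`. -/
theorem netExp_siteOp (θ : Param p) (i : Fin p) (g : Config p → ℝ) :
    netExp θ (siteOp θ i g) = netExp θ g := by
  let e : Config p × Bool → Config p × Bool := fun z => (Function.update z.1 i z.2, z.1 i)
  have he : Function.Involutive e := by
    rintro ⟨x, b⟩
    simp [e]
  have h1 : netExp θ (siteOp θ i g) =
      ∑ z : Config p × Bool, prob θ z.1 * (condProb θ i z.1 z.2 *
        g (Function.update z.1 i z.2)) := by
    rw [Fintype.sum_prod_type]
    exact Finset.sum_congr rfl fun x _ => Finset.mul_sum _ _ _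
  have h2 : netExp θ g = ∑ z : Config p × Bool, prob θ z.1 * (condProb θ i z.1 z.2 * g z.1) := by
    rw [Fintype.sum_prod_type]
    unfold netExp
    refine Finset.sum_congr rfl fun x _ => ?_
    change _ = ∑ b, prob θ x * (condProb θ i x b * g x)
    rw [← Finset.mul_sum, ← Finset.sum_mul, sum_condProb, one_mul]
  rw [h1, h2]
  refine Fintype.sum_equiv he.toPerm _ _ ?_
  rintro ⟨x, b⟩
  simp only [Function.Involutive.coe_toPerm, e, condProb, Function.update_idem,
    Function.update_eq_self]
  ring

theorem netExp_scanOp (θ : Param p) (g : Config p → ℝ) : netExp θ (scanOp θ g) = netExp θ g := by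
  unfold scanOp
  induction List.finRange p with
  | nil => rfl
  | cons i l ih => rw [List.foldr_cons, netExp_siteOp, ih]

theorem netExp_iterate_scanOp (θ : Param p) (t : ℕ) (g : Config p → ℝ) :
    netExp θ ((scanOp θ)^[t] g) = netExp θ g := by
  induction t generalizing g with
  | zero => rfl
  | succ t ih => rw [Function.iterate_succ_apply, ih, netExp_scanOp]

/-! ### Dependence of the conditional distributions on a single coordinate -/

/-- The log-odds of `X_i = 1` given the other coordinates. -/
noncomputable def logOdds (θ : Param p) (i : Fin p) (x : Config p) : ℝ :=
  ∑ k, xi θ i k * (if k = i then 1 else bit (x k))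

theorem inner_suffStat (θ : Param p) (x : Config p) :
    inner ℝ θ (suffStat x) = ∑ e : PairIdx p, θ e * (bit (x e.1.1) * bit (x e.1.2)) := by
  rw [PiLp.inner_apply]
  refine Finset.sum_congr rfl fun e _ => ?_
  simp [suffStat, mul_comm]

theorem inner_suffStat_update (θ : Param p) (i : Fin p) (x : Config p) :
    inner ℝ θ (suffStat (Function.update x i true)) =
      inner ℝ θ (suffStat (Function.update x i false)) + logOdds θ i x := by
  rw [← sub_eq_iff_eq_add', inner_suffStat, inner_suffStat, ← Finset.sum_sub_distrib, logOdds]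
  symm
  -- `f` enumerates the pairs containing `i`; all other pairs contribute zero to the difference.
  let f : Fin p → PairIdx p := fun k => ⟨(min i k, max i k), min_le_max⟩
  have hf : Function.Injective f := by
    intro k l h
    have h1 : min i k = min i l := congrArg (fun e : PairIdx p => e.1.1) h
    have h2 : max i k = max i l := congrArg (fun e : PairIdx p => e.1.2) h
    rcases le_total i k with h3 | h3 <;> rcases le_total i l with h4 | h4 <;>
      simp only [h3, h4, min_eq_left, min_eq_right, max_eq_left, max_eq_right] at h1 h2 <;>
      simp_all
  refine Fintype.sum_of_injective f hf _ _ ?_ ?_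
  · rintro ⟨⟨a, b⟩, hab⟩ he
    have ha : a ≠ i := by
      rintro rfl
      exact he ⟨b, by simp only [f]; congr 2 <;> simpa using hab⟩
    have hb : b ≠ i := by
      rintro rfl
      exact he ⟨a, by simp only [f]; congr 2 <;> simpa using hab⟩
    simp [ha, hb]
  · intro k
    simp only [f, xi]
    rcases eq_or_ne k i with rfl | hk
    · simp [bit]
    · rcases le_total i k with h | h <;> simp [h, hk, bit]

theorem condProb_true (θ : Param p) (i : Fin p) (x : Config p) :
    condProb θ i x true = 1 / (1 + Real.exp (-logOdds θ i x)) := by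
  unfold condProb prob
  rw [Fintype.sum_bool, inner_suffStat_update, Real.exp_add, Real.exp_neg]
  have h1 := Real.exp_pos (logPartition θ)
  have h2 := Real.exp_pos (logOdds θ i x)
  have h3 := Real.exp_pos (inner ℝ θ (suffStat (Function.update x i false)))
  field_simp

theorem logOdds_update (θ : Param p) {i j : Fin p} (hij : j ≠ i) (x : Config p) (b : Bool) :
    logOdds θ i (Function.update x j b) =
      (xi θ i i + ∑ k with k ≠ i ∧ k ≠ j, xi θ i k * bit (x k)) + xi θ i j * bit b := by
  unfold logOdds
  rw [← Finset.add_sum_erase _ _ (Finset.mem_univ i),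
    ← Finset.add_sum_erase _ _ (Finset.mem_erase.2 ⟨hij, Finset.mem_univ j⟩)]
  have : (Finset.univ.erase i).erase j = Finset.univ.filter (fun k => k ≠ i ∧ k ≠ j) := by
    ext k
    simp [and_comm]
  rw [this]
  have h : ∑ k with k ≠ i ∧ k ≠ j, xi θ i k *
      (if k = i then 1 else bit (Function.update x j b k)) =
      ∑ k with k ≠ i ∧ k ≠ j, xi θ i k * bit (x k) := by
    refine Finset.sum_congr rfl fun k hk => ?_
    obtain ⟨h1, h2⟩ := (Finset.mem_filter.1 hk).2
    simp [h1, h2]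
  rw [h]
  simp [hij]
  ring

theorem bit_mem (b : Bool) : 0 ≤ bit b ∧ bit b ≤ 1 := by
  cases b <;> simp [bit]

theorem mul_max_sign_bounds (a : ℝ) {t : ℝ} (h0 : 0 ≤ t) (h1 : t ≤ 1) :
    a * max (-Real.sign a) 0 ≤ a * t ∧ a * t ≤ a * max (Real.sign a) 0 := by
  rcases lt_trichotomy a 0 with h | rfl | h
  · rw [Real.sign_of_neg h]
    norm_num
    constructor <;> nlinarith
  · simp
  · rw [Real.sign_of_pos h]
    norm_num
    constructor <;> nlinarith

theorem exp_neg_mem_bounds (θ : Param p) (i j : Fin p) (x : Config p) :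
    rBound θ i j ≤
        Real.exp (-(xi θ i i + ∑ k with k ≠ i ∧ k ≠ j, xi θ i k * bit (x k))) ∧
      Real.exp (-(xi θ i i + ∑ k with k ≠ i ∧ k ≠ j, xi θ i k * bit (x k))) ≤
        sBound θ i j := by
  unfold rBound sBound
  rw [neg_add']
  constructor
  · refine Real.exp_le_exp.2 (sub_le_sub_left (Finset.sum_le_sum fun k _ => ?_) _)
    exact (mul_max_sign_bounds _ (bit_mem (x k)).1 (bit_mem (x k)).2).2
  · refine Real.exp_le_exp.2 (sub_le_sub_left (Finset.sum_le_sum fun k _ => ?_) _)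
    exact (mul_max_sign_bounds _ (bit_mem (x k)).1 (bit_mem (x k)).2).1

theorem bStar_pos (θ : Param p) (i j : Fin p) : 0 < bStar θ i j :=
  lt_max_of_lt_left (Real.exp_pos _)

theorem matU_nonneg (θ : Param p) (i j : Fin p) : 0 ≤ matU θ i j := by
  have := bStar_pos θ i j
  simp only [matU, Matrix.of_apply]
  positivity

/-- The unimodal function `b ↦ b / ((1 + b m⁻²) (1 + b))` is maximised over `[r, s]` at the
projection of `m` to `[r, s]`. -/
theorem div_le_div_clamp {r s m b : ℝ} (hr : 0 < r) (hm : 0 < m) (hrb : r ≤ b) (hbs : b ≤ s) :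
    b / ((1 + b * (m ^ 2)⁻¹) * (1 + b)) ≤
      max r (min s m) / ((1 + max r (min s m) * (m ^ 2)⁻¹) * (1 + max r (min s m))) := by
  have hb : 0 < b := hr.trans_le hrb
  have hc : 0 < max r (min s m) := lt_max_of_lt_left hr
  -- With `c` the clamped point and `w = m⁻²`, cross-multiplying reduces the claim to `0 ≤ (b - c) *
  -- (w * b * c - 1)`.
  have key : 0 ≤ (b - max r (min s m)) * (b * max r (min s m) - m ^ 2) := by
    rcases le_total m r with h | h
    · rw [max_eq_left ((min_le_right _ _).trans h)]
      exact mul_nonneg (by linarith) (by nlinarith)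
    · rcases le_total s m with h' | h'
      · rw [min_eq_left h', max_eq_right (hrb.trans hbs)]
        exact mul_nonneg_of_nonpos_of_nonpos (by linarith) (by nlinarith)
      · rw [min_eq_right h', max_eq_right h]
        nlinarith [mul_nonneg hm.le (sq_nonneg (b - m))]
  generalize max r (min s m) = c at hc key
  have hm2 : (m ^ 2)⁻¹ * m ^ 2 = 1 := inv_mul_cancel₀ (by positivity)
  have hw : 0 < (m ^ 2)⁻¹ := by positivity
  generalize (m ^ 2)⁻¹ = w at hm2 hw
  rw [div_le_div_iff₀ (by positivity) (by positivity)]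
  have : 0 ≤ w * ((b - c) * (b * c - m ^ 2)) := mul_nonneg hw.le key
  have h2 : w * ((b - c) * (b * c - m ^ 2)) = (b - c) * (w * b * c - 1) := by
    linear_combination (-(b - c)) * hm2
  nlinarith

theorem abs_inv_one_add_sub {w b : ℝ} (hw : 0 < w) (hb : 0 < b) :
    |1 / (1 + b * w) - 1 / (1 + b)| = |w - 1| * (b / ((1 + b * w) * (1 + b))) := by
  have h : 1 / (1 + b * w) - 1 / (1 + b) = -(w - 1) * (b / ((1 + b * w) * (1 + b))) := by
    field_simp
    ring
  rw [h, abs_mul, abs_neg, abs_of_pos (a := b / _) (by positivity)]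

/-- The two conditional probabilities are `1 / (1 + b w)` and `1 / (1 + b)` with `w = exp(-ξ_ij)`,
where `b` depends on the remaining coordinates and lies in `[r, s]`. The worst `b` is the clamp of
`w^(-1/2) = exp(ξ_ij / 2)`, which is `b*`. -/
theorem abs_condProb_update_sub_le (θ : Param p) {i j : Fin p} (hij : j ≠ i) (x : Config p)
    (a b : Bool) :
    |condProb θ i (Function.update x j a) true - condProb θ i (Function.update x j b) true| ≤
      matU θ i j := by
  have main : |condProb θ i (Function.update x j true) true -
      condProb θ i (Function.update x j false) true| ≤ matU θ i j := by
    rw [condProb_true, condProb_true, logOdds_update θ hij, logOdds_update θ hij]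
    obtain ⟨h1, h2⟩ := exp_neg_mem_bounds θ i j x
    generalize xi θ i i + ∑ k with k ≠ i ∧ k ≠ j, xi θ i k * bit (x k) = c at h1 h2
    simp only [bit, if_true, Bool.false_eq_true, if_false, mul_one, mul_zero, add_zero]
    rw [neg_add, Real.exp_add, abs_inv_one_add_sub (Real.exp_pos _) (Real.exp_pos _)]
    simp only [matU, Matrix.of_apply]
    rw [mul_div_assoc]
    refine mul_le_mul_of_nonneg_left ?_ (abs_nonneg _)
    have h3 : Real.exp (-xi θ i j) = (Real.exp (xi θ i j / 2) ^ 2)⁻¹ := by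
      rw [← Real.exp_nat_mul, ← Real.exp_neg]
      congr 1
      push_cast
      ring
    rw [h3]
    exact div_le_div_clamp (Real.exp_pos _) (Real.exp_pos _) h1 h2
  cases a <;> cases b
  · simpa using matU_nonneg θ i j
  · rwa [abs_sub_comm]
  · exact main
  · simpa using matU_nonneg θ i j

/-! ### Contraction of oscillations -/

/-- `d i` bounds the change of `g` under a change of the `i`-th coordinate. -/
def OscLE (g : Config p → ℝ) (d : Fin p → ℝ) : Prop :=
  ∀ i x a b, |g (Function.update x i a) - g (Function.update x i b)| ≤ d i

theorem OscLE.nonneg {g : Config p → ℝ} {d : Fin p → ℝ} (h : OscLE g d) (i : Fin p) :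
    0 ≤ d i :=
  (abs_nonneg _).trans (h i (fun _ => true) true true)

theorem vecMul_matBSite (θ : Param p) (i j : Fin p) (d : Fin p → ℝ) :
    Matrix.vecMul d (matBSite θ i) j = (if j = i then 0 else d j) + d i * matU θ i j := by
  simp only [Matrix.vecMul, dotProduct, matBSite, Matrix.updateRow_apply]
  rw [← Finset.add_sum_erase _ _ (Finset.mem_univ i), if_pos rfl, add_comm]
  congr 1
  rw [Finset.sum_congr rfl (g := fun k => if k = j then d k else 0)]
  · rw [Finset.sum_ite_eq']
    by_cases h : j = i <;> simp [h]
  · intro k hk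
    rw [if_neg (Finset.ne_of_mem_erase hk), Matrix.one_apply, mul_ite, mul_one, mul_zero]

/-- Resampling `i` removes the dependence on `x_i`. A flip of `x_j` with `j ≠ i` changes `g` under a
fixed conditional law, at cost `d j`, and changes that law by at most `U_ij`, at cost `d i * U_ij`.
-/
theorem OscLE.siteOp {g : Config p → ℝ} {d : Fin p → ℝ} (h : OscLE g d) (θ : Param p)
    (i : Fin p) : OscLE (siteOp θ i g) (Matrix.vecMul d (matBSite θ i)) := by
  intro j x a b
  rw [vecMul_matBSite]
  have hU := mul_nonneg (h.nonneg i) (matU_nonneg θ i j)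
  split_ifs with hj
  · subst hj
    -- The change is zero here; of `U_ii` only nonnegativity matters.
    simpa [BPMN.siteOp, condProb] using hU
  · have hc := abs_condProb_update_sub_le θ hj x a b
    have s1 := sum_condProb θ i (Function.update x j a)
    have s2 := sum_condProb θ i (Function.update x j b)
    have n1 := condProb_nonneg θ i (Function.update x j a) true
    have n2 := condProb_nonneg θ i (Function.update x j a) false
    simp only [BPMN.siteOp]
    rw [Fintype.sum_bool] at s1 s2
    rw [Fintype.sum_bool, Fintype.sum_bool]
    have g1 := h j (Function.update x i true) a b
    have g2 := h j (Function.update x i false) a b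
    have g3 := h i (Function.update x j b) true false
    rw [Function.update_comm (Ne.symm hj), Function.update_comm (Ne.symm hj)] at g1 g2
    generalize condProb θ i (Function.update x j a) true = u at *
    generalize condProb θ i (Function.update x j b) true = v at *
    rw [eq_sub_of_add_eq' s1] at n2 ⊢
    rw [eq_sub_of_add_eq' s2]
    generalize g (Function.update (Function.update x j a) i true) = A at *
    generalize g (Function.update (Function.update x j a) i false) = B at *
    generalize g (Function.update (Function.update x j b) i true) = C at *
    generalize g (Function.update (Function.update x j b) i false) = D at *
    have e : u * A + (1 - u) * B - (v * C + (1 - v) * D) =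
        (u * (A - C) + (1 - u) * (B - D)) + (u - v) * (C - D) := by ring
    rw [e]
    refine (abs_add_le _ _).trans (add_le_add ?_ ?_)
    · refine (abs_add_le _ _).trans ?_
      rw [abs_mul, abs_mul, abs_of_nonneg n1, abs_of_nonneg n2]
      nlinarith
    · rw [abs_mul, mul_comm]
      exact mul_le_mul g3 hc (abs_nonneg _) (h.nonneg i)

/-- On functions the last coordinate's operator acts first, and a row vector meets the leftmost
factor first; hence the order `B_p ⋯ B_1`. -/
theorem OscLE.scanOp {g : Config p → ℝ} {d : Fin p → ℝ} (h : OscLE g d) (θ : Param p) :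
    OscLE (scanOp θ g) (Matrix.vecMul d (matB θ)) := by
  unfold BPMN.scanOp matB
  induction List.finRange p with
  | nil => simpa using h
  | cons i l ih =>
    rw [List.foldr_cons, List.reverse_cons, List.map_append, List.prod_append, List.map_singleton,
      List.prod_singleton, ← Matrix.vecMul_vecMul]
    exact ih.siteOp θ i

theorem OscLE.iterate_scanOp {g : Config p → ℝ} {d : Fin p → ℝ} (h : OscLE g d) (θ : Param p)
    (t : ℕ) : OscLE ((BPMN.scanOp θ)^[t] g) (Matrix.vecMul d (matB θ ^ t)) := by
  induction t generalizing g d with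
  | zero => simpa using h
  | succ t ih =>
    rw [Function.iterate_succ_apply, pow_succ', ← Matrix.vecMul_vecMul]
    exact ih (h.scanOp θ)

/-- Move from `x` to `y` one coordinate at a time. -/
theorem OscLE.abs_sub_le_of_eqOn {g : Config p → ℝ} {d : Fin p → ℝ} (h : OscLE g d)
    (s : Finset (Fin p)) (x y : Config p) (hxy : ∀ i ∉ s, x i = y i) :
    |g x - g y| ≤ ∑ i ∈ s, d i := by
  induction s using Finset.induction_on generalizing x with
  | empty =>
    obtain rfl : x = y := funext fun i => hxy i (Finset.notMem_empty i)
    simp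
  | insert i s hi ih =>
    rw [Finset.sum_insert hi]
    have h1 := h i x (x i) (y i)
    rw [Function.update_eq_self] at h1
    refine (abs_sub_le _ (g (Function.update x i (y i))) _).trans (add_le_add h1 (ih _ ?_))
    intro k hk
    rcases eq_or_ne k i with rfl | hki
    · simp
    · rw [Function.update_of_ne hki]
      exact hxy k (by simp [hki, hk])

theorem OscLE.abs_sub_le {g : Config p → ℝ} {d : Fin p → ℝ} (h : OscLE g d) (x y : Config p) :
    |g x - g y| ≤ ∑ i, d i :=
  h.abs_sub_le_of_eqOn Finset.univ x y (by simp)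

theorem sum_one_vecMul (M : Matrix (Fin p) (Fin p) ℝ) :
    ∑ j, Matrix.vecMul (fun _ => (1 : ℝ)) M j = grandSum M := by
  simp only [Matrix.vecMul, dotProduct, one_mul, grandSum]
  exact Finset.sum_comm

/-- The bias of Gibbs-`τ` is at most the grand sum of `B ^ τ`. -/
theorem abs_pmfExp_gibbs_sub_netExp_le (θ : Param p) (x₀ : Config p) (t : ℕ)
    {g : Config p → ℝ} (hg : OscLE g fun _ => 1) :
    |pmfExp (gibbs θ x₀ t) g - netExp θ g| ≤ grandSum (matB θ ^ t) := by
  -- By stationarity both terms involve the same function: its value at `x₀` and its network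
  -- average.
  rw [pmfExp_gibbs, ← netExp_iterate_scanOp θ t g]
  have h := (hg.iterate_scanOp θ t).abs_sub_le
  rw [sum_one_vecMul] at h
  generalize (scanOp θ)^[t] g = k at h
  have e : k x₀ - netExp θ k = ∑ x, prob θ x * (k x₀ - k x) := by
    simp_rw [mul_sub]
    rw [Finset.sum_sub_distrib, ← Finset.sum_mul, sum_prob, one_mul, netExp]
  rw [e]
  refine (Finset.abs_sum_le_sum_abs _ _).trans ?_
  calc ∑ x, |prob θ x * (k x₀ - k x)| ≤ ∑ x, prob θ x * grandSum (matB θ ^ t) := by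
        refine Finset.sum_le_sum fun x _ => ?_
        rw [abs_mul, abs_of_pos (prob_pos θ x)]
        exact mul_le_mul_of_nonneg_left (h x₀ x) (prob_pos θ x).le
    _ = grandSum (matB θ ^ t) := by rw [← Finset.sum_mul, sum_prob, one_mul]

theorem oscLE_suffStat (e : PairIdx p) : OscLE (fun x => suffStat x e) fun _ => 1 := by
  intro i x a b
  have h : ∀ y : Config p, suffStat y e ∈ Set.Icc (0 : ℝ) 1 := fun y =>
    ⟨mul_nonneg (bit_mem _).1 (bit_mem _).1,
      mul_le_one₀ (bit_mem _).2 (bit_mem _).1 (bit_mem _).2⟩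
  simpa using abs_sub_le_of_le_of_le (h (Function.update x i a)).1 (h (Function.update x i a)).2
    (h (Function.update x i b)).1 (h (Function.update x i b)).2

end BPMN

namespace BPMN

/-! ### Bernstein's inequality -/

theorem exp_le_one_add_add_sq {l x : ℝ} (hl0 : 0 ≤ l) (hl : l < 1) (hx : x ≤ l) :
    Real.exp x ≤ 1 + x + x ^ 2 / (2 * (1 - l)) := by
  rcases le_total x 0 with h | h
  · have h1 := Real.quadratic_le_exp_of_nonneg (neg_nonneg.2 h)
    have h2 : x ^ 2 / 2 ≤ x ^ 2 / (2 * (1 - l)) :=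
      div_le_div_of_nonneg_left (sq_nonneg x) (by linarith) (by linarith)
    refine le_trans ?_ (add_le_add_right h2 _)
    rw [Real.exp_neg] at h1
    have h3 : 0 < 1 + -x + (-x) ^ 2 / 2 := by nlinarith
    have h4 := (le_inv_comm₀ h3 (Real.exp_pos x)).1 h1
    refine h4.trans ?_
    -- `(1 - x + x²/2)(1 + x + x²/2) = 1 + x⁴/4`.
    rw [inv_le_iff_one_le_mul₀ h3]
    nlinarith [sq_nonneg (x ^ 2)]
  · have h1 := Real.exp_bound' h (hx.trans hl.le) (n := 3) (by norm_num)
    norm_num [Finset.sum_range_succ, Nat.factorial] at h1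
    refine h1.trans ?_
    -- After clearing denominators this is `(4/9) x³ (1 - l) ≤ l x²`, which follows from `x ≤ l`.
    have h2 : x ^ 2 / 2 + x ^ 3 * 4 / 18 ≤ x ^ 2 / (2 * (1 - l)) := by
      rw [le_div_iff₀ (by linarith)]
      have : 0 ≤ x ^ 2 * (l - x) := mul_nonneg (sq_nonneg x) (by linarith)
      have : 0 ≤ x ^ 3 * l := by positivity
      have : 0 ≤ x ^ 2 * l := by positivity
      nlinarith
    linarith

variable {Ω : Type*} [MeasurableSpace Ω] {P : Measure Ω} [IsProbabilityMeasure P]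

theorem mgf_le_exp_sq {Y : Ω → ℝ} (hY : Measurable Y) (hb : ∀ ω, |Y ω| ≤ 1) (h0 : ∫ ω, Y ω ∂P = 0)
    {l : ℝ} (hl0 : 0 ≤ l) (hl : l < 1) :
    mgf Y P l ≤ Real.exp (l ^ 2 * (∫ ω, Y ω ^ 2 ∂P) / (2 * (1 - l))) := by
  have i1 : Integrable Y P :=
    Integrable.of_bound hY.aestronglyMeasurable 1 (Filter.Eventually.of_forall hb)
  have i2 : Integrable (fun ω => Y ω ^ 2) P :=
    Integrable.of_bound (hY.pow_const 2).aestronglyMeasurable 1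
      (Filter.Eventually.of_forall fun ω => by
        rw [norm_pow]
        exact pow_le_one₀ (norm_nonneg _) (hb ω))
  have i0 : Integrable (fun ω => 1 + l * Y ω) P := (integrable_const 1).add (i1.const_mul l)
  have i3 : Integrable (fun ω => 1 + l * Y ω + l ^ 2 / (2 * (1 - l)) * Y ω ^ 2) P :=
    i0.add (i2.const_mul _)
  calc mgf Y P l ≤ ∫ ω, (1 + l * Y ω + l ^ 2 / (2 * (1 - l)) * Y ω ^ 2) ∂P := by
        refine integral_mono_of_nonneg (Filter.Eventually.of_forall fun ω => (Real.exp_pos _).le)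
          i3 (Filter.Eventually.of_forall fun ω => ?_)
        have h := exp_le_one_add_add_sq hl0 hl (x := l * Y ω)
          (mul_le_of_le_one_right hl0 ((le_abs_self _).trans (hb ω)))
        refine h.trans_eq ?_
        ring
    _ = 1 + l ^ 2 * (∫ ω, Y ω ^ 2 ∂P) / (2 * (1 - l)) := by
        rw [integral_add i0 (i2.const_mul _),
          integral_add (integrable_const 1) (i1.const_mul l), integral_const_mul,
          integral_const_mul, h0]
        simp
        ring
    _ ≤ _ := by
        rw [add_comm]
        exact Real.add_one_le_exp _

/-- Bernstein's inequality for a sum of independent centred variables bounded by `1`. -/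
theorem bernstein {q : ℕ} {Y : Fin q → Ω → ℝ} (hY : ∀ k, Measurable (Y k))
    (hind : iIndepFun Y P) (hb : ∀ k ω, |Y k ω| ≤ 1) (h0 : ∀ k, ∫ ω, Y k ω ∂P = 0) {σ : ℝ}
    (hσ : 0 ≤ σ) (h2 : ∀ k, ∫ ω, Y k ω ^ 2 ∂P = σ ^ 2) {s : ℝ} (hs : 0 < s) :
    P.real {ω | q * (σ * s + 3 / 4 * s ^ 2) ≤ ∑ k, Y k ω} ≤ Real.exp (-(q * (s ^ 2 / 2))) := by
  have hd : 0 < σ + 3 / 2 * s := by positivity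
  -- Chernoff parameter. The constant `3/2`, twice the `3/4` of the threshold, keeps `l < 1` even
  -- for `σ = 0` and makes `l * (σ s + 3/4 s²)` equal `s²/2` plus a bound for the mgf exponent.
  set l := s / (σ + 3 / 2 * s) with hl
  have hl0 : 0 ≤ l := by positivity
  have hl1 : l < 1 := by
    rw [hl, div_lt_one hd]
    linarith
  have hm : mgf (∑ k, Y k) P l ≤ Real.exp (l ^ 2 * σ ^ 2 / (2 * (1 - l))) ^ q := by
    rw [hind.mgf_sum hY]
    calc _ ≤ ∏ _k : Fin q, Real.exp (l ^ 2 * σ ^ 2 / (2 * (1 - l))) := by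
          refine Finset.prod_le_prod (fun k _ => mgf_nonneg) fun k _ => ?_
          rw [← h2 k]
          exact mgf_le_exp_sq (hY k) (hb k) (h0 k) hl0 hl1
      _ = _ := by simp
  have hint : Integrable (fun ω => Real.exp (l * (∑ k, Y k) ω)) P := by
    refine Integrable.of_bound (C := Real.exp (l * q)) ?_ (Filter.Eventually.of_forall fun ω => ?_)
    · have : Measurable (∑ k, Y k) := by fun_prop
      exact (Real.measurable_exp.comp (this.const_mul l)).aestronglyMeasurable
    · rw [Real.norm_eq_abs, Real.abs_exp, Real.exp_le_exp, Finset.sum_apply]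
      refine mul_le_mul_of_nonneg_left ?_ hl0
      calc ∑ k, Y k ω ≤ ∑ _k : Fin q, (1 : ℝ) :=
            Finset.sum_le_sum fun k _ => (le_abs_self _).trans (hb k ω)
        _ = q := by simp
  have hch := measure_ge_le_exp_mul_mgf (μ := P) (X := ∑ k, Y k)
    (q * (σ * s + 3 / 4 * s ^ 2)) hl0 hint
  simp only [Finset.sum_apply] at hch
  refine hch.trans ((mul_le_mul_of_nonneg_left hm (Real.exp_pos _).le).trans ?_)
  rw [← Real.exp_nat_mul, ← Real.exp_add, Real.exp_le_exp]
  have key : l ^ 2 * σ ^ 2 / (2 * (1 - l)) + s ^ 2 / 2 ≤ l * (σ * s + 3 / 4 * s ^ 2) := by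
    have h1 : 1 - l = (σ + 1 / 2 * s) / (σ + 3 / 2 * s) := by
      rw [hl]
      field_simp
      ring
    have h3 : l ^ 2 * σ ^ 2 / (2 * (1 - l)) =
        s ^ 2 * σ ^ 2 / (2 * (σ + 3 / 2 * s) * (σ + 1 / 2 * s)) := by
      have : 0 < σ + 1 / 2 * s := by positivity
      rw [h1, hl]
      field_simp
    have h4 : s ^ 2 * σ ^ 2 / (2 * (σ + 3 / 2 * s) * (σ + 1 / 2 * s)) ≤
        s ^ 2 * σ / (2 * (σ + 3 / 2 * s)) := by
      rw [div_le_div_iff₀ (by positivity) (by positivity)]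
      have : 0 ≤ s ^ 3 * σ * (σ + 3 / 2 * s) := by positivity
      nlinarith
    have h5 : l * (σ * s + 3 / 4 * s ^ 2) =
        s ^ 2 * σ / (2 * (σ + 3 / 2 * s)) + s ^ 2 / 2 := by
      rw [hl]
      field_simp
      ring
    rw [h3, h5]
    linarith
  nlinarith [mul_le_mul_of_nonneg_left key (Nat.cast_nonneg (α := ℝ) q)]

/-- Two-sided version of Bernstein's inequality. -/
theorem bernstein_abs {q : ℕ} {Y : Fin q → Ω → ℝ} (hY : ∀ k, Measurable (Y k))
    (hind : iIndepFun Y P) (hb : ∀ k ω, |Y k ω| ≤ 1) (h0 : ∀ k, ∫ ω, Y k ω ∂P = 0) {σ : ℝ}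
    (hσ : 0 ≤ σ) (h2 : ∀ k, ∫ ω, Y k ω ^ 2 ∂P = σ ^ 2) {s : ℝ} (hs : 0 < s) :
    P.real {ω | q * (σ * s + 3 / 4 * s ^ 2) ≤ |∑ k, Y k ω|} ≤
      2 * Real.exp (-(q * (s ^ 2 / 2))) := by
  have b1 := bernstein hY hind hb h0 hσ h2 hs
  have b2 := bernstein (Y := fun k ω => -Y k ω) (fun k => (hY k).neg)
    (hind.comp (fun _ y => -y) fun _ => measurable_neg) (fun k ω => by simpa using hb k ω)
    (fun k => by rw [integral_neg, h0, neg_zero]) hσ (fun k => by simpa using h2 k) hs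
  rw [two_mul]
  refine le_trans ?_ ((measureReal_union_le _ _).trans (add_le_add b1 b2))
  refine measureReal_mono ?_ (measure_ne_top _ _)
  intro ω hω
  rw [Set.mem_ofPred_eq, le_abs] at hω
  simpa [Set.mem_union, Finset.sum_neg_distrib] using hω

/-- Passing from the true to the empirical standard deviation in Bernstein's bound. -/
theorem le_of_le_bernstein {d σ v s : ℝ} (hs : 0 ≤ s) (hv : 0 ≤ v)
    (h1 : d ≤ σ * s + 3 / 4 * s ^ 2) (h2 : σ ^ 2 ≤ v + d) :
    d ≤ Real.sqrt v * s + 9 / 4 * s ^ 2 := by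
  have hr := Real.sqrt_nonneg v
  have hsq := Real.sq_sqrt hv
  -- The hypotheses give `σ (σ - s) ≤ v + 3/4 s²`, and `3/2` is the positive root of `x² - x = 3/4`.
  have h3 : σ ≤ Real.sqrt v + 3 / 2 * s := by
    by_contra! h
    nlinarith [mul_nonneg hs hr, mul_nonneg hs hs]
  nlinarith

end BPMN

/-! ### Empirical Bernstein inequality for binary variables -/

namespace BPMN

/-- An empirical Bernstein inequality for independent `{0, 1}`-valued variables. -/
theorem empirical_bernstein {Ω : Type*} [MeasurableSpace Ω] {P : Measure Ω}
    [IsProbabilityMeasure P] {q : ℕ} (hq : 2 ≤ q) {Z : Fin q → Ω → ℝ}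
    (hZ : ∀ k, Measurable (Z k)) (hind : iIndepFun Z P) (h01 : ∀ k ω, Z k ω = 0 ∨ Z k ω = 1)
    {μ : ℝ} (hμ : ∀ k, ∫ ω, Z k ω ∂P = μ) {β : ℝ} (hβ : 0 < β) :
    P.real {ω | 2 * (Real.sqrt
        ((∑ k, (Z k ω - (q : ℝ)⁻¹ * ∑ l, Z l ω) ^ 2) / ((q : ℝ) - 1) * Real.log (2 / β) /
          (2 * q)) + 7 * Real.log (2 / β) / (3 * ((q : ℝ) - 1))) <
        |(q : ℝ)⁻¹ * ∑ k, Z k ω - μ|} ≤ 2 * β := by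
  -- For `β ≥ 1` the bound exceeds 1; otherwise `ln(2/β)` is positive.
  rcases le_or_gt 1 β with h1 | h1
  · exact measureReal_le_one.trans (by linarith)
  have hq' : (2 : ℝ) ≤ q := by exact_mod_cast hq
  have hL : 0 < Real.log (2 / β) := Real.log_pos (by rw [lt_div_iff₀ hβ]; linarith)
  have hexp : Real.exp (-Real.log (2 / β)) = β / 2 := by
    rw [Real.exp_neg, Real.exp_log (by positivity), inv_div]
  generalize Real.log (2 / β) = L at hL hexp
  have hmem : ∀ k ω, 0 ≤ Z k ω ∧ Z k ω ≤ 1 := fun k ω => by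
    rcases h01 k ω with h | h <;> rw [h] <;> norm_num
  have hint : ∀ k, Integrable (Z k) P := fun k =>
    Integrable.of_bound (hZ k).aestronglyMeasurable 1 (Filter.Eventually.of_forall fun ω => by
      rw [Real.norm_eq_abs, abs_of_nonneg (hmem k ω).1]
      exact (hmem k ω).2)
  let k₀ : Fin q := ⟨0, by omega⟩
  have hμ0 : 0 ≤ μ := hμ k₀ ▸ integral_nonneg fun ω => (hmem k₀ ω).1
  have hμ1 : μ ≤ 1 := by
    rw [← hμ k₀]
    refine (integral_mono (hint k₀) (integrable_const 1) fun ω => (hmem k₀ ω).2).trans_eq ?_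
    simp
  have hvar : 0 ≤ μ * (1 - μ) := mul_nonneg hμ0 (by linarith)
  -- The choice `s² = 2L/q` makes the Bernstein exponent equal to `L`, so the two tails together
  -- have mass at most `β`.
  have hs : 0 < Real.sqrt (2 * L / q) := Real.sqrt_pos.2 (by positivity)
  have hs2 : Real.sqrt (2 * L / q) ^ 2 = 2 * L / q := Real.sq_sqrt (by positivity)
  have hB := bernstein_abs (P := P) (Y := fun k ω => Z k ω - μ) (fun k => (hZ k).sub_const μ)
    (hind.comp (fun _ z => z - μ) fun _ => measurable_id.sub_const μ)
    (fun k ω => by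
      rw [abs_le]
      constructor <;> linarith [hmem k ω])
    (fun k => by
      rw [integral_sub (hint k) (integrable_const μ), hμ]
      simp)
    (Real.sqrt_nonneg (μ * (1 - μ)))
    (fun k => by
      rw [Real.sq_sqrt hvar]
      have e : ∀ ω, (Z k ω - μ) ^ 2 = (1 - 2 * μ) * Z k ω + μ ^ 2 := by
        intro ω
        rcases h01 k ω with h | h <;> rw [h] <;> ring
      simp_rw [e]
      rw [integral_add ((hint k).const_mul _) (integrable_const _), integral_const_mul, hμ]
      simp
      ring) hs
  have he : (q : ℝ) * (Real.sqrt (2 * L / q) ^ 2 / 2) = L := by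
    rw [hs2]
    field_simp
  rw [he, hexp] at hB
  refine le_trans (measureReal_mono ?_ (measure_ne_top _ _)) (hB.trans (by linarith))
  intro ω hω
  by_contra hcon
  simp only [Set.mem_ofPred_eq, not_le] at hω hcon
  refine absurd hω (not_lt.2 ?_)
  have hsum : ∑ k, Z k ω = q * ((q : ℝ)⁻¹ * ∑ k, Z k ω) := by
    field_simp
  have hm0 : 0 ≤ (q : ℝ)⁻¹ * ∑ k, Z k ω :=
    mul_nonneg (by positivity) (Finset.sum_nonneg fun k _ => (hmem k ω).1)
  have hm1 : (q : ℝ)⁻¹ * ∑ k, Z k ω ≤ 1 := by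
    have : ∑ k, Z k ω ≤ ∑ _k : Fin q, (1 : ℝ) := Finset.sum_le_sum fun k _ => (hmem k ω).2
    rw [inv_mul_le_iff₀ (by positivity)]
    simpa using this
  generalize (q : ℝ)⁻¹ * ∑ k, Z k ω = m at hsum hm0 hm1
  -- Since `Z² = Z`, the sample variance depends on the sample mean alone.
  have hV : ∑ k, (Z k ω - m) ^ 2 = q * (m * (1 - m)) := by
    have e : ∀ k, (Z k ω - m) ^ 2 = (1 - 2 * m) * Z k ω + m ^ 2 := by
      intro k
      rcases h01 k ω with h | h <;> rw [h] <;> ring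
    simp_rw [e]
    rw [Finset.sum_add_distrib, ← Finset.mul_sum, hsum]
    simp
    ring
  have hd : |m - μ| ≤ Real.sqrt (μ * (1 - μ)) * Real.sqrt (2 * L / q) +
      3 / 4 * Real.sqrt (2 * L / q) ^ 2 := by
    have e : ∑ k, (Z k ω - μ) = q * (m - μ) := by
      rw [Finset.sum_sub_distrib, hsum]
      simp
      ring
    rw [e, abs_mul, abs_of_pos (by positivity : (0 : ℝ) < q)] at hcon
    exact (lt_of_mul_lt_mul_left hcon (by positivity)).le
  have hv : 0 ≤ m * (1 - m) := mul_nonneg hm0 (by linarith)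
  -- `μ(1-μ) - m(1-m) = (μ-m)(1-μ-m)`, and the last factor is at most 1 in absolute value.
  have hfin := le_of_le_bernstein hs.le hv hd (by
    rw [Real.sq_sqrt hvar]
    rcases abs_cases (m - μ) with ⟨h, _⟩ | ⟨h, _⟩ <;> rw [h] <;> nlinarith)
  refine hfin.trans ?_
  rw [hV, hs2, ← Real.sqrt_mul hv, mul_add]
  refine add_le_add ?_ ?_
  · rw [← Real.sqrt_sq (zero_le_two (α := ℝ)), ← Real.sqrt_mul (sq_nonneg _)]
    refine Real.sqrt_le_sqrt ?_
    have h3 : m * (1 - m) ≤ q * (m * (1 - m)) / (q - 1) := by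
      rw [le_div_iff₀ (by linarith)]
      nlinarith
    have h4 := mul_le_mul_of_nonneg_right h3 (by positivity : 0 ≤ 2 * L / q)
    rw [Real.sqrt_sq (zero_le_two (α := ℝ))]
    refine h4.trans_eq ?_
    field_simp
  -- The remainder `9/4 · 2L/q = (9/2) L/q` is below `(14/3) L/(q-1)`.
  · have h5 : L / q ≤ L / (q - 1) :=
      div_le_div_of_nonneg_left hL.le (by linarith) (by linarith)
    have h6 : 0 < L / q := by positivity
    have h7 : 2 * (7 * L / (3 * ((q : ℝ) - 1))) = 14 / 3 * (L / (q - 1)) := by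
      have : (q : ℝ) - 1 ≠ 0 := by linarith
      field_simp
      norm_num
    rw [h7, mul_div_assoc]
    linarith

/-! ### The gradient of the objective -/

variable {p : ℕ}

theorem hasFDerivAt_inner_suffStat (θ : Param p) (x : Config p) :
    HasFDerivAt (fun η : Param p => inner ℝ η (suffStat x))
      (innerSL ℝ (suffStat x)) θ := by
  simpa only [real_inner_comm, coe_innerSL_apply] using
    (innerSL ℝ (suffStat x)).hasFDerivAt (x := θ)

theorem hasFDerivAt_logPartition (θ : Param p) :
    HasFDerivAt (logPartition (p := p)) (innerSL ℝ (∑ x, prob θ x • suffStat x)) θ := by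
  have h := (HasFDerivAt.fun_sum (u := Finset.univ) fun x _ =>
    (hasFDerivAt_inner_suffStat θ x).exp).log (sum_exp_pos θ).ne'
  refine h.congr_fderiv ?_
  rw [map_sum, Finset.smul_sum]
  refine Finset.sum_congr rfl fun x _ => ?_
  rw [map_smul, smul_smul]
  congr 1
  rw [prob, logPartition, Real.exp_log (sum_exp_pos θ)]
  field_simp

theorem gradient_negLogLik {n : ℕ} (data : Fin n → Config p) (θ : Param p) :
    gradient (negLogLik data) θ = -empMean data + ∑ x, prob θ x • suffStat x := by
  apply HasGradientAt.gradient
  rw [hasGradientAt_iff_hasFDerivAt]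
  have h := (((HasFDerivAt.fun_sum (u := Finset.univ) fun k _ =>
    hasFDerivAt_inner_suffStat θ (data k)).const_mul ((n : ℝ)⁻¹)).neg).add
      (hasFDerivAt_logPartition θ)
  refine h.congr_fderiv ?_
  ext v
  simp [empMean]

theorem gradError_apply {n q : ℕ} (data : Fin n → Config p) (s : Fin q → Config p)
    (θ : Param p) (j : PairIdx p) :
    gradError data s θ j = empMean s j - netExp θ (fun x => suffStat x j) := by
  simp only [gradError, approxGrad, gradient_negLogLik, netExp]
  simp
  ring

/-! ### Combination of bias and sampling error -/

theorem empMean_apply {q : ℕ} (s : Fin q → Config p) (j : PairIdx p) :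
    empMean s j = (q : ℝ)⁻¹ * ∑ k, suffStat (s k) j := by
  simp [empMean]

theorem suffStat_eq_zero_or_one (x : Config p) (j : PairIdx p) :
    suffStat x j = 0 ∨ suffStat x j = 1 := by
  simp only [suffStat, bit]
  split_ifs <;> simp

/-- A vector each of whose coordinates splits into a part at most `G` and a part at most `e j`
has Euclidean norm at most `√m G + √(∑ e_j²)`. -/
theorem norm_le_of_abs_le {ι : Type*} [Fintype ι] (v : EuclideanSpace ℝ ι) (e : ι → ℝ) {G : ℝ}
    (hG : 0 ≤ G) (he : ∀ j, 0 ≤ e j) (h : ∀ j, |v j| ≤ G + e j) :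
    ‖v‖ ≤ Real.sqrt (Fintype.card ι) * G + Real.sqrt (∑ j, e j ^ 2) := by
  let a : EuclideanSpace ℝ ι := WithLp.toLp 2 fun _ => G
  let b : EuclideanSpace ℝ ι := WithLp.toLp 2 e
  have h1 : ‖v‖ ≤ ‖a + b‖ := by
    rw [EuclideanSpace.norm_eq, EuclideanSpace.norm_eq]
    refine Real.sqrt_le_sqrt (Finset.sum_le_sum fun j _ => pow_le_pow_left₀ (norm_nonneg _) ?_ 2)
    simp only [a, b, PiLp.add_apply, Real.norm_eq_abs]
    rw [abs_of_nonneg (add_nonneg hG (he j))]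
    exact h j
  refine h1.trans ((norm_add_le a b).trans_eq ?_)
  congr 1
  · simp [a, EuclideanSpace.norm_eq, abs_of_nonneg hG, Real.sqrt_sq hG]
  · simp [b, EuclideanSpace.norm_eq]

theorem two_mul_sqrt_mul_sqrt_div {m S : ℝ} (hm : 0 < m) :
    2 * Real.sqrt m * Real.sqrt (S / (4 * m)) = Real.sqrt S := by
  have h : 2 * Real.sqrt m = Real.sqrt (4 * m) := by
    rw [Real.sqrt_mul (by norm_num), show (4 : ℝ) = 2 ^ 2 by norm_num,
      Real.sqrt_sq zero_le_two]
  rw [h, ← Real.sqrt_mul (by positivity), mul_div_cancel₀ _ (by positivity)]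

theorem abs_gradError_le {n q : ℕ} (τ : ℕ) (data : Fin n → Config p) (θ : Param p)
    (x₀ : Config p) (s : Fin q → Config p) (j : PairIdx p) {e : ℝ}
    (h : |empMean s j - pmfExp (gibbs θ x₀ τ) fun x => suffStat x j| ≤ e) :
    |gradError data s θ j| ≤ grandSum (matB θ ^ τ) + e := by
  rw [gradError_apply, add_comm]
  exact (abs_sub_le _ _ _).trans
    (add_le_add h (abs_pmfExp_gibbs_sub_netExp_le θ x₀ τ (oscLE_suffStat j)))

theorem norm_gradError_le {n q : ℕ} (τ : ℕ) (data : Fin n → Config p) (θ : Param p)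
    (x₀ : Config p) (s : Fin q → Config p) (e : PairIdx p → ℝ)
    (h : ∀ j, |empMean s j - pmfExp (gibbs θ x₀ τ) fun x => suffStat x j| ≤ e j) :
    ‖gradError data s θ‖ ≤ 2 * Real.sqrt (dim p) *
      (grandSum (matB θ ^ τ) + Real.sqrt ((∑ j, e j ^ 2) / (4 * dim p))) := by
  -- With no components the norm and the factor `√m` both vanish.
  rcases isEmpty_or_nonempty (PairIdx p) with hE | hE
  · simp [EuclideanSpace.norm_eq, dim]
  have hm : (0 : ℝ) < dim p := by exact_mod_cast Fintype.card_pos (α := PairIdx p)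
  have hG : 0 ≤ grandSum (matB θ ^ τ) := (abs_nonneg _).trans
    (abs_pmfExp_gibbs_sub_netExp_le θ x₀ τ (oscLE_suffStat (Classical.arbitrary (PairIdx p))))
  rw [mul_add, two_mul_sqrt_mul_sqrt_div hm]
  refine (norm_le_of_abs_le _ e hG (fun j => (abs_nonneg _).trans (h j))
    fun j => abs_gradError_le τ data θ x₀ s j (h j)).trans ?_
  -- The bias term needs only `√m`; the factor 2 is slack there.
  gcongr
  rw [dim]
  linarith [Real.sqrt_nonneg (Fintype.card (PairIdx p) : ℝ)]

theorem measureReal_epsilon_lt_le {q : ℕ} (hq : 2 ≤ q) {Ω : Type*} [MeasurableSpace Ω]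
    {P : Measure Ω} [IsProbabilityMeasure P] {X : Fin q → Ω → Config p}
    (hX_meas : ∀ k, Measurable (X k)) {ν : PMF (Config p)}
    (hX_law : ∀ k, P.map (X k) = ν.toMeasure) (hX_indep : iIndepFun X P) {b : ℝ} (hb : 0 < b)
    (j : PairIdx p) :
    P.real {ω | epsilon (fun k => X k ω) b j <
      |empMean (fun k => X k ω) j - pmfExp ν fun x => suffStat x j|} ≤ 2 * b := by
  have hS : Measurable fun x : Config p => suffStat x j := Measurable.of_discrete
  have h := empirical_bernstein (P := P) hq (Z := fun k ω => suffStat (X k ω) j)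
    (fun k => hS.comp (hX_meas k)) (hX_indep.comp (fun _ x => suffStat x j) fun _ => hS)
    (fun k ω => suffStat_eq_zero_or_one _ j) (μ := pmfExp ν fun x => suffStat x j)
    (fun k => by
      rw [← integral_map (f := fun x : Config p => suffStat x j) (hX_meas k).aemeasurable
        hS.aestronglyMeasurable, hX_law, PMF.integral_eq_sum]
      rfl) hb
  simpa only [epsilon, sampleVar, empMean_apply] using h

end BPMN

/-! ### Union bound over the components -/

theorem theorem4 {p n q : ℕ} (hq : 2 ≤ q) (τ : ℕ)
    (data : Fin n → BPMN.Config p) (θ : BPMN.Param p) (x₀ : BPMN.Config p)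
    {Ω : Type*} [MeasurableSpace Ω] (P : Measure Ω) [IsProbabilityMeasure P]
    (X : Fin q → Ω → BPMN.Config p)
    (hX_meas : ∀ k, Measurable (X k))
    (hX_law : ∀ k, P.map (X k) = (BPMN.gibbs θ x₀ τ).toMeasure)
    (hX_indep : iIndepFun X P)
    (β : BPMN.PairIdx p → ℝ) (hβ : ∀ j, 0 < β j) :
    1 - 2 * ∑ j, β j ≤
      P.real {ω | ‖BPMN.gradError data (fun k => X k ω) θ‖ ≤
        2 * Real.sqrt (BPMN.dim p) *
          (BPMN.grandSum (BPMN.matB θ ^ τ) +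
            Real.sqrt ((∑ j, BPMN.epsilon (fun k => X k ω) (β j) j ^ 2) /
              (4 * BPMN.dim p)))} := by
  let bad : BPMN.PairIdx p → Set Ω := fun j => {ω | BPMN.epsilon (fun k => X k ω) (β j) j <
    |BPMN.empMean (fun k => X k ω) j -
      BPMN.pmfExp (BPMN.gibbs θ x₀ τ) fun x => BPMN.suffStat x j|}
  set good : Set Ω := {ω | ‖BPMN.gradError data (fun k => X k ω) θ‖ ≤
        2 * Real.sqrt (BPMN.dim p) *
          (BPMN.grandSum (BPMN.matB θ ^ τ) +
            Real.sqrt ((∑ j, BPMN.epsilon (fun k => X k ω) (β j) j ^ 2) /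
              (4 * BPMN.dim p)))}
  -- Covering the space and using subadditivity requires no measurability of `good`.
  have hcover : good ∪ ⋃ j, bad j = Set.univ := by
    refine Set.eq_univ_of_forall fun ω => ?_
    by_cases h : ∃ j, ω ∈ bad j
    · exact Or.inr (Set.mem_iUnion.2 h)
    · push Not at h
      exact Or.inl (BPMN.norm_gradError_le τ data θ x₀ _ _ fun j => not_lt.1 (h j))
  have hbad : P.real (⋃ j, bad j) ≤ 2 * ∑ j, β j := by
    rw [Finset.mul_sum]
    exact (measureReal_iUnion_fintype_le _).trans (Finset.sum_le_sum fun j _ =>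
      BPMN.measureReal_epsilon_lt_le hq hX_meas hX_law hX_indep (hβ j) j)
  have h1 : P.real Set.univ ≤ P.real good + P.real (⋃ j, bad j) :=
    hcover ▸ measureReal_union_le _ _
  rw [probReal_univ] at h1
  linarith
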